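/- Let $R$ be an associative unital ring (not necessarily commutative), let $m\ge 0$ be an integer, and let $F$ be an $\aleph_m$-presentable flat $R$-module. Here an $R$-module is called $\aleph_m$-presentable if it is (isomorphic to) the cokernel of a morphism of free $R$-modules with less than $\aleph_m$ generators. Then the projective dimension of $F$ does not exceed $m$. -/

import Mathlib

open scoped TensorProduct

universe u v w

/-- An `R`-module `M` is `κ`-presentable if it is the cokernel of a morphism of free `R`-modules
with less than `κ` generators. -/
def IsCardPresentable (κ : Cardinal.{w}) (R : Type u) [Ring R]
    (M : Type v) [AddCommGroup M] [Module R M] : Prop :=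
  ∃ (ι σ : Type w) (φ : (σ →₀ R) →ₗ[R] (ι →₀ R)),
    Cardinal.mk ι < κ ∧ Cardinal.mk σ < κ ∧
      Nonempty (((ι →₀ R) ⧸ LinearMap.range φ) ≃ₗ[R] M)

namespace BalancedTensor

open MulOpposite

section

variable (R : Type*) [Ring R]
  (N : Type*) [AddCommGroup N] [Module Rᵐᵒᵖ N]
  (M : Type*) [AddCommGroup M] [Module R M]

/-- The subgroup of `N ⊗[ℤ] M` generated by the elements `n r ⊗ m - n ⊗ r m`, where `N` is a right
and `M` a left `R`-module. -/
def relations : AddSubgroup (N ⊗[ℤ] M) :=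
  AddSubgroup.closure
    {x | ∃ (n : N) (r : R) (m : M), x = (op r • n) ⊗ₜ[ℤ] m - n ⊗ₜ[ℤ] (r • m)}

/-- The tensor product `N ⊗_R M`, an abelian group, of a right module `N` (a module over `Rᵐᵒᵖ`)
and a left module `M` over a not necessarily commutative ring `R`. -/
abbrev Tensor : Type _ := (N ⊗[ℤ] M) ⧸ relations R N M

end

variable {R : Type*} [Ring R]
  {N : Type*} [AddCommGroup N] [Module Rᵐᵒᵖ N]
  {P : Type*} [AddCommGroup P] [Module Rᵐᵒᵖ P]
  (M : Type*) [AddCommGroup M] [Module R M]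

theorem relations_le_comap (f : N →ₗ[Rᵐᵒᵖ] P) :
    relations R N M ≤ (relations R P M).comap
      ((f.toAddMonoidHom.toIntLinearMap).rTensor M).toAddMonoidHom := by
  refine (AddSubgroup.closure_le _).2 ?_
  rintro _ ⟨n, r, m, rfl⟩
  refine AddSubgroup.subset_closure ⟨f n, r, m, ?_⟩
  simp

/-- The homomorphism `f ⊗_R M : N ⊗_R M → P ⊗_R M` induced by a morphism `f` of right modules. -/
def map (f : N →ₗ[Rᵐᵒᵖ] P) : Tensor R N M →+ Tensor R P M :=
  QuotientAddGroup.map _ _ ((f.toAddMonoidHom.toIntLinearMap).rTensor M).toAddMonoidHom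
    (relations_le_comap M f)

end BalancedTensor

/-- A left module `M` over a ring `R` is flat if `- ⊗_R M` takes injective morphisms of right
`R`-modules to injective maps. (By the ideal criterion, test modules in the universe of `R` are
enough.) -/
def IsFlatModule (R : Type u) [Ring R] (M : Type v) [AddCommGroup M] [Module R M] : Prop :=
  ∀ ⦃N P : Type u⦄ [AddCommGroup N] [Module Rᵐᵒᵖ N] [AddCommGroup P] [Module Rᵐᵒᵖ P]
    (f : N →ₗ[Rᵐᵒᵖ] P), Function.Injective f → Function.Injective (BalancedTensor.map M f)

/-! ### Dimension shifting along short exact sequences. -/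

section ProjDim
open CategoryTheory

variable {R : Type u} [Ring R]

/-! Write `F = P/K` with `P` free and `K` generated by fewer than `ℵ_m` elements. Flatness of `F`
makes `K` locally split (`IsFlatModule.isLocallySplit_ker`). If `m = 0`, `K` is finitely generated,
so one endomorphism fixes all of it and `P → P/K` splits. If `m = n + 1`, `K` has at most `ℵ_n`
generators, and it suffices that `K` has projective dimension at most `n`. This goes by induction on
`n`. For countably many generators, a telescoping series makes `K` a retract of a sum of copies of
`P`. In the inductive step, well-order the generators and close initial segments under finitary
operations that preserve local splitness. This filters `K` by locally split submodules with fewer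
generators, the factors have dimension at most `n + 1`, and Auslander's lemma concludes. -/

theorem hasProjectiveDimensionLE_zero_iff (M : Type u) [AddCommGroup M] [Module R M] :
    HasProjectiveDimensionLE (ModuleCat.of R M) 0 ↔ Module.Projective R M := by
  rw [← projective_iff_hasProjectiveDimensionLE_zero, ← IsProjective.iff_projective]

variable {A B C : Type u} [AddCommGroup A] [Module R A] [AddCommGroup B] [Module R B]
  [AddCommGroup C] [Module R C]

theorem shortExact_mk_ofHom (f : A →ₗ[R] B) (g : B →ₗ[R] C) (hf : Function.Injective f)
    (hg : Function.Surjective g) (hfg : LinearMap.range f = LinearMap.ker g) :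
    (ShortComplex.mk (ModuleCat.ofHom f) (ModuleCat.ofHom g)
      (by ext x; exact (hfg.le ⟨x, rfl⟩ : f x ∈ LinearMap.ker g))).ShortExact where
  exact := (ShortComplex.moduleCat_exact_iff_range_eq_ker _).2 hfg
  mono_f := (ModuleCat.mono_iff_injective _).2 hf
  epi_g := (ModuleCat.epi_iff_surjective _).2 hg

theorem hasProjectiveDimensionLE_succ_of_exact {n : ℕ} (f : A →ₗ[R] B) (g : B →ₗ[R] C)
    (hf : Function.Injective f) (hg : Function.Surjective g)
    (hfg : LinearMap.range f = LinearMap.ker g)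
    (hA : HasProjectiveDimensionLE (ModuleCat.of R A) n)
    (hB : HasProjectiveDimensionLE (ModuleCat.of R B) (n + 1)) :
    HasProjectiveDimensionLE (ModuleCat.of R C) (n + 1) :=
  (shortExact_mk_ofHom f g hf hg hfg).hasProjectiveDimensionLT_X₃ (n + 1) hA hB

theorem hasProjectiveDimensionLE_of_exact_of_projective {n : ℕ} (f : A →ₗ[R] B) (g : B →ₗ[R] C)
    (hf : Function.Injective f) (hg : Function.Surjective g)
    (hfg : LinearMap.range f = LinearMap.ker g) [Module.Projective R B] :
    HasProjectiveDimensionLE (ModuleCat.of R C) (n + 1) ↔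
      HasProjectiveDimensionLE (ModuleCat.of R A) n :=
  (shortExact_mk_ofHom f g hf hg hfg).hasProjectiveDimensionLT_X₃_iff n
    ((IsProjective.iff_projective B).1 ‹_›)

theorem hasProjectiveDimensionLE_mono {m n : ℕ} (h : m ≤ n)
    (hA : HasProjectiveDimensionLE (ModuleCat.of R A) m) :
    HasProjectiveDimensionLE (ModuleCat.of R A) n :=
  hasProjectiveDimensionLT_of_ge _ (m + 1) (n + 1) (by lia)

end ProjDim

/-! ### Locally split submodules. -/

section LocallySplit

variable {R : Type u} [Ring R] {P : Type v} [AddCommGroup P] [Module R P]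

/-- A submodule `K` of `P` is locally split if every finitely generated submodule of `K` is fixed
pointwise by an endomorphism of `P` whose range lies in a finitely generated submodule of `K`. -/
def Submodule.IsLocallySplit (K : Submodule R P) : Prop :=
  ∀ L : Submodule R P, L.FG → L ≤ K → ∃ (f : P →ₗ[R] P) (L' : Submodule R P),
    L'.FG ∧ L' ≤ K ∧ (∀ x, f x ∈ L') ∧ ∀ x ∈ L, f x = x

/-- If `f₁` fixes `s` and `f₂` fixes `a - f₁ a`, then `1 - (1 - f₂)(1 - f₁)` fixes both `s` and `a`.
-/
theorem Submodule.isLocallySplit_of_forall_mem {K : Submodule R P}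
    (h : ∀ k ∈ K, ∃ (f : P →ₗ[R] P) (L' : Submodule R P),
      L'.FG ∧ L' ≤ K ∧ (∀ x, f x ∈ L') ∧ f k = k) : K.IsLocallySplit := by
  classical
  rintro _ ⟨s, rfl⟩
  induction s using Finset.induction_on with
  | empty => exact fun _ => ⟨0, ⊥, Submodule.fg_bot, bot_le, by simp, by simp⟩
  | insert a s ha ih =>
    intro hL
    rw [Finset.coe_insert, Submodule.span_insert, sup_le_iff] at hL
    obtain ⟨f₁, L₁, fg₁, le₁, mem₁, fix₁⟩ := ih hL.2
    have haK : a - f₁ a ∈ K :=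
      K.sub_mem (hL.1 (Submodule.mem_span_singleton_self a)) (le₁ (mem₁ a))
    obtain ⟨f₂, L₂, fg₂, le₂, mem₂, fix₂⟩ := h _ haK
    refine ⟨f₁ + f₂ ∘ₗ (LinearMap.id - f₁), L₁ ⊔ L₂, fg₁.sup fg₂, sup_le le₁ le₂,
      fun x => Submodule.add_mem_sup (mem₁ x) (mem₂ _), ?_⟩
    rw [Finset.coe_insert]
    intro x hx
    refine LinearMap.eqOn_span (f := f₁ + f₂ ∘ₗ (LinearMap.id - f₁)) (g := LinearMap.id) ?_ hx
    rintro y (rfl | hy)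
    · simp [fix₂]
    · simp [fix₁ y (Submodule.subset_span hy)]

end LocallySplit

/-! ### Kernels of maps from free modules onto flat modules. -/

section Flat

open MulOpposite

variable {R : Type u} [Ring R]

/-- The elements `f k`, for `f` running over the endomorphisms of `P` whose range lies in a finitely
generated submodule of `K`. -/
def Submodule.finiteRankOrbit {P : Type v} [AddCommGroup P] [Module R P] (K : Submodule R P)
    (k : P) : AddSubgroup P where
  carrier := {y | ∃ (f : P →ₗ[R] P) (L : Submodule R P),
    L.FG ∧ L ≤ K ∧ (∀ x, f x ∈ L) ∧ f k = y}
  zero_mem' := ⟨0, ⊥, Submodule.fg_bot, bot_le, by simp, by simp⟩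
  add_mem' := by
    rintro _ _ ⟨f, L, h1, h2, h3, rfl⟩ ⟨f', L', h1', h2', h3', rfl⟩
    exact ⟨f + f', L ⊔ L', h1.sup h1', sup_le h2 h2',
      fun x => Submodule.add_mem_sup (h3 x) (h3' x), rfl⟩
  neg_mem' := by
    rintro _ ⟨f, L, h1, h2, h3, rfl⟩
    exact ⟨-f, L, h1, h2, fun x => L.neg_mem (h3 x), rfl⟩

/-- The right ideal generated by the coordinates of a vector. -/
def coordIdeal {ι : Type w} (k : ι →₀ R) : Submodule Rᵐᵒᵖ R :=
  Submodule.span Rᵐᵒᵖ (Set.range k)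

/-- The map `y ↦ y j • x` has range in `R ∙ x` and sends `k` to `k j • x`; right multiples of `k j`
are absorbed by `x`. -/
theorem smul_mem_finiteRankOrbit {ι : Type w} (K : Submodule R (ι →₀ R)) (k : ι →₀ R)
    {i : R} (hi : i ∈ coordIdeal k) : ∀ x ∈ K, i • x ∈ K.finiteRankOrbit k := by
  induction hi using Submodule.span_induction with
  | mem i hi =>
    obtain ⟨j, rfl⟩ := hi
    intro x hx
    refine ⟨(LinearMap.toSpanSingleton R _ x) ∘ₗ Finsupp.lapply j, R ∙ x,
      Submodule.fg_span_singleton x, ?_, ?_, ?_⟩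
    · rwa [Submodule.span_singleton_le_iff_mem]
    · intro y
      exact Submodule.mem_span_singleton.2 ⟨y j, rfl⟩
    · rfl
  | zero => intro x _; rw [zero_smul]; exact zero_mem _
  | add a b _ _ ha hb => intro x hx; rw [add_smul]; exact add_mem (ha x hx) (hb x hx)
  | smul a b _ hb =>
    intro x hx
    have : a • b = b * unop a := rfl
    rw [this, mul_smul]
    exact hb _ (K.smul_mem _ hx)

variable {ι : Type w} {F : Type v} [AddCommGroup F] [Module R F]

/-- The action of the coordinate ideal of `k` induces a homomorphism to the quotient by the finite
rank orbit of `k`. -/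
noncomputable def idealAction (K : Submodule R (ι →₀ R)) (k : ι →₀ R) :
    coordIdeal k →+ ((ι →₀ R) ⧸ K) →+ ((ι →₀ R) ⧸ K.finiteRankOrbit k) where
  toFun i := QuotientAddGroup.lift K.toAddSubgroup
    ((QuotientAddGroup.mk' _).comp (DistribSMul.toAddMonoidHom (ι →₀ R) (i : R)))
    (fun x hx => (QuotientAddGroup.eq_zero_iff _).2 (smul_mem_finiteRankOrbit K k i.2 x hx))
  map_zero' := by
    ext x
    obtain ⟨x, rfl⟩ := Submodule.Quotient.mk_surjective _ x
    change QuotientAddGroup.mk ((0 : R) • x) = _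
    rw [zero_smul]
    rfl
  map_add' i j := by
    ext x
    obtain ⟨x, rfl⟩ := Submodule.Quotient.mk_surjective _ x
    change QuotientAddGroup.mk (((i : R) + (j : R)) • x) =
      QuotientAddGroup.mk ((i : R) • x) + QuotientAddGroup.mk ((j : R) • x)
    rw [add_smul]; rfl

/-- Let `I` be the right ideal of coordinates of `k ∈ K` and `z = ∑ k_j ⊗ π e_j` in `I ⊗ F`. Its
image in `R ⊗ F` is `1 ⊗ π k = 0`, so `z = 0` by flatness. But `i ⊗ π x ↦ i x` is well defined
modulo the finite rank orbit of `k` and sends `z` to the class of `k`. -/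
theorem IsFlatModule.isLocallySplit_ker (hF : IsFlatModule R F) (π : (ι →₀ R) →ₗ[R] F)
    (hπ : Function.Surjective π) : (LinearMap.ker π).IsLocallySplit := by
  refine Submodule.isLocallySplit_of_forall_mem fun k hk => ?_
  set K := LinearMap.ker π with hK
  let e : ((ι →₀ R) ⧸ K) ≃ₗ[R] F := π.quotKerEquivOfSurjective hπ
  let W := K.finiteRankOrbit k
  let c : ι → coordIdeal k := fun j => ⟨k j, Submodule.subset_span ⟨j, rfl⟩⟩
  let Θ : (coordIdeal k) ⊗[ℤ] F →+ (ι →₀ R) ⧸ W :=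
    TensorProduct.liftAddHom
      ((AddMonoidHom.compHom' e.symm.toLinearMap.toAddMonoidHom).comp (idealAction K k))
      (by intro r m n; simp)
  have hΘ : ∀ (i : coordIdeal k) (x : ι →₀ R),
      Θ (i ⊗ₜ π x) = QuotientAddGroup.mk ((i : R) • x) := by
    intro i x
    have : e.symm (π x) = Submodule.Quotient.mk x := by
      rw [LinearEquiv.symm_apply_eq]; rfl
    change idealAction K k i (e.symm (π x)) = _
    rw [this]; rfl
  let Θ' : BalancedTensor.Tensor R (coordIdeal k) F →+ (ι →₀ R) ⧸ W :=
    QuotientAddGroup.lift _ Θ (by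
      refine (AddSubgroup.closure_le _).2 ?_
      rintro _ ⟨i, r, m, rfl⟩
      obtain ⟨x, rfl⟩ := hπ m
      change Θ _ = 0
      rw [map_sub, ← map_smul, hΘ, hΘ, sub_eq_zero, ← mul_smul]
      rfl)
  let z : (coordIdeal k) ⊗[ℤ] F := k.support.sum fun j => c j ⊗ₜ π (Finsupp.single j 1)
  have hz : BalancedTensor.map F (coordIdeal k).subtype (QuotientAddGroup.mk z) = 0 := by
    change QuotientAddGroup.mk (LinearMap.rTensor F _ z) = _
    have key : ∀ (r : R) (m : F), (QuotientAddGroup.mk (r ⊗ₜ[ℤ] m) : BalancedTensor.Tensor R R F) =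
        QuotientAddGroup.mk ((1 : R) ⊗ₜ[ℤ] (r • m)) := by
      intro r m
      rw [← sub_eq_zero, ← QuotientAddGroup.mk_sub, QuotientAddGroup.eq_zero_iff]
      exact AddSubgroup.subset_closure ⟨1, r, m, by simp⟩
    have h0 : ∑ j ∈ k.support, (c j : R) • π (Finsupp.single j 1) = π k := by
      conv_rhs => rw [← Finsupp.sum_single k, Finsupp.sum, map_sum]
      refine Finset.sum_congr rfl fun j _ => ?_
      rw [← map_smul, Finsupp.smul_single, smul_eq_mul, mul_one]
    let q := QuotientAddGroup.mk' (BalancedTensor.relations R R F)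
    calc q (LinearMap.rTensor F _ z)
        = ∑ j ∈ k.support, q ((c j : R) ⊗ₜ π (Finsupp.single j 1)) := by
          simp only [z, map_sum]; rfl
      _ = ∑ j ∈ k.support, q ((1 : R) ⊗ₜ ((c j : R) • π (Finsupp.single j 1))) :=
          Finset.sum_congr rfl fun j _ => key _ _
      _ = q ((1 : R) ⊗ₜ ∑ j ∈ k.support, (c j : R) • π (Finsupp.single j 1)) := by
          rw [TensorProduct.tmul_sum, map_sum]
      _ = 0 := by
          rw [h0, LinearMap.mem_ker.1 hk, TensorProduct.tmul_zero, map_zero]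
  have hz' : (QuotientAddGroup.mk z : BalancedTensor.Tensor R (coordIdeal k) F) = 0 :=
    hF (coordIdeal k).subtype Subtype.val_injective (hz.trans (map_zero _).symm)
  have h1 : Θ z = 0 := by
    change Θ' (QuotientAddGroup.mk z) = 0
    rw [hz', map_zero]
  have h2 : Θ z = QuotientAddGroup.mk k := by
    simp only [z, map_sum, hΘ]
    conv_rhs => rw [← Finsupp.sum_single k, Finsupp.sum]
    refine Eq.trans (Finset.sum_congr rfl fun j _ => ?_)
      (map_sum (QuotientAddGroup.mk' W) _ _).symm
    rw [Finsupp.smul_single, smul_eq_mul, mul_one]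
    rfl
  exact (QuotientAddGroup.eq_zero_iff _).1 (h2.symm.trans h1)

end Flat

/-! ### Finitely and countably generated locally split submodules. -/

section CountablyGenerated

variable {R : Type u} [Ring R] {P : Type v} [AddCommGroup P] [Module R P]

/-- If `f` fixes `K` and has range in `K`, then `1 - f` induces a section of `P → P ⧸ K`. -/
theorem Submodule.IsLocallySplit.projective_quotient [Module.Projective R P] {K : Submodule R P}
    (hK : K.IsLocallySplit) (hfg : K.FG) : Module.Projective R (P ⧸ K) := by
  obtain ⟨f, L', _, hL', hf, hfix⟩ := hK K hfg le_rfl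
  refine Module.Projective.of_split (K.liftQ (LinearMap.id - f) fun x hx => ?_) K.mkQ ?_
  · simp [hfix x hx]
  · ext x
    simpa using hL' (hf x)

theorem Submodule.IsLocallySplit.exists_chain {K : Submodule R P} (hK : K.IsLocallySplit)
    (g : ℕ → P) (hg : Submodule.span R (Set.range g) = K) :
    ∃ (u : ℕ → P →ₗ[R] P) (L : ℕ → Submodule R P), Monotone L ∧ (∀ n, g n ∈ L (n + 1)) ∧
      (∀ n, L n ≤ K) ∧ (∀ n x, u n x ∈ L (n + 1)) ∧ ∀ n, ∀ x ∈ L n, u n x = x := by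
  choose! f L' fg le mem fix using hK
  have hgK : ∀ n, g n ∈ K := fun n => hg ▸ Submodule.subset_span ⟨n, rfl⟩
  let L : ℕ → Submodule R P := fun n =>
    Nat.rec ⊥ (fun n M => M ⊔ L' M ⊔ R ∙ g n) n
  have hL : ∀ n, L (n + 1) = L n ⊔ L' (L n) ⊔ R ∙ g n := fun n => rfl
  have key : ∀ n, (L n).FG ∧ L n ≤ K := by
    intro n
    induction n with
    | zero => exact ⟨Submodule.fg_bot, bot_le⟩
    | succ n ih =>
      rw [hL]
      refine ⟨(ih.1.sup (fg _ ih.1 ih.2)).sup (Submodule.fg_span_singleton _),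
        sup_le (sup_le ih.2 (le _ ih.1 ih.2)) ?_⟩
      rw [Submodule.span_singleton_le_iff_mem]
      exact hgK n
  refine ⟨fun n => f (L n), L, monotone_nat_of_le_succ fun n => ?_, fun n => ?_, fun n => (key n).2,
    fun n x => ?_, fun n x hx => fix _ (key n).1 (key n).2 x hx⟩
  · rw [hL]; exact le_sup_left.trans le_sup_left
  · rw [hL]; exact Submodule.mem_sup_right (Submodule.mem_span_singleton_self _)
  · rw [hL]
    exact Submodule.mem_sup_left (Submodule.mem_sup_right (mem _ (key n).1 (key n).2 x))

/-- On `K` the increments of the `u n` telescope to the identity, with finitely many nonzero terms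
at each point. Since `a i x ∈ L (i + 1)` is fixed by `u (i + 1)`, summing the `u (i + 1)` retracts
`⨁ P` onto `K`. -/
theorem Submodule.IsLocallySplit.projective_of_countable [Module.Projective R P]
    {K : Submodule R P} (hK : K.IsLocallySplit) (g : ℕ → P)
    (hg : Submodule.span R (Set.range g) = K) : Module.Projective R K := by
  obtain ⟨u, L, mono, hgL, le, mem, fix⟩ := hK.exists_chain g hg
  have hex : ∀ x ∈ K, ∃ n, x ∈ L n := by
    have : K ≤ ⨆ n, L n := by
      rw [← hg, Submodule.span_le]
      rintro _ ⟨n, rfl⟩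
      exact Submodule.mem_iSup_of_mem _ (hgL n)
    intro x hx
    exact (Submodule.mem_iSup_of_directed _ mono.directed_le).1 (this hx)
  -- the increments `a n` of the sequence `0, u 0, u 1, …`
  let a : ℕ → P →ₗ[R] P := fun n => Nat.casesOn n (u 0) fun n => u (n + 1) - u n
  have hsum : ∀ n x, ∑ i ∈ Finset.range (n + 1), a i x = u n x := by
    intro n x
    induction n with
    | zero => simp [a]
    | succ n ih => rw [Finset.sum_range_succ, ih]; simp [a]
  have hmem : ∀ n x, a n x ∈ L (n + 1) := by
    rintro (_ | n) x
    · exact mem 0 x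
    · exact Submodule.sub_mem _ (mem _ x) (mono (Nat.le_succ _) (mem n x))
  have hzero : ∀ n, ∀ x ∈ L n, ∀ i, n < i → a i x = 0 := by
    rintro n x hx (_ | i) hi
    · omega
    · simp only [a, LinearMap.sub_apply]
      rw [fix _ _ (mono (by omega) hx), fix _ _ (mono (by omega) hx), sub_self]
  have hfin : ∀ x : K, (Function.support fun i => a i x).Finite := by
    intro x
    obtain ⟨n, hn⟩ := hex x x.2
    refine (Set.finite_Iic n).subset fun i hi => ?_
    by_contra h
    exact hi (hzero n x hn i (not_le.1 h))
  let s : K →ₗ[R] (ℕ →₀ P) :=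
    { toFun := fun x => Finsupp.ofSupportFinite (fun i => a i x) (hfin x)
      map_add' := fun x y => by ext i; exact map_add (a i) (x : P) y
      map_smul' := fun r x => by ext i; exact map_smul (a i) r (x : P) }
  let t : (ℕ →₀ P) →ₗ[R] K :=
    Finsupp.lsum ℕ fun n => (u (n + 1)).codRestrict K fun x => le _ (mem _ x)
  have : Module.Projective R (ℕ →₀ P) := by
    classical exact Module.Projective.of_equiv' (finsuppLequivDFinsupp R).symm
  refine Module.Projective.of_split s t ?_
  ext x
  obtain ⟨n, hn⟩ := hex x x.2
  have h1 : t (s x) = ∑ i ∈ Finset.range (n + 1),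
      (u (i + 1)).codRestrict K (fun x => le _ (mem _ x)) (a i x) := by
    simp only [t, Finsupp.coe_lsum]
    refine Finsupp.sum_of_support_subset _ (fun i hi => ?_) _ (by simp)
    rw [Finset.mem_range]
    by_contra h
    exact Finsupp.mem_support_iff.1 hi (hzero n x hn i (by omega))
  simp only [LinearMap.comp_apply, h1, LinearMap.id_apply, AddSubmonoidClass.coe_finsetSum,
    LinearMap.codRestrict_apply]
  rw [Finset.sum_congr rfl fun i _ => fix (i + 1) _ (hmem i x), hsum, fix n x hn]

end CountablyGenerated

/-! ### Filtrations with projective factors. -/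

section Filtration

variable {R : Type u} [Ring R] {I : Type w} [LinearOrder I]

theorem Submodule.mem_iSup_of_monotone {E : Type v} [AddCommGroup E] [Module R E]
    {N : I → Submodule R E} (hN : Monotone N) {x : E} :
    x ∈ ⨆ j, N j ↔ x = 0 ∨ ∃ j, x ∈ N j := by
  rcases isEmpty_or_nonempty I with h | h
  · simp [iSup_of_empty]
  · rw [Submodule.mem_iSup_of_directed N hN.directed_le]
    constructor
    · exact Or.inr
    · rintro (rfl | h)
      · exact ⟨Classical.arbitrary I, zero_mem _⟩
      · exact h

/-- Sections of the `p i` add up to an isomorphism from `⨁ Q i`: the largest index in the support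
gives injectivity, well-founded induction gives surjectivity. -/
theorem projective_iSup_of_filtration [WellFoundedLT I] {E : Type v} [AddCommGroup E] [Module R E]
    (N : I → Submodule R E)
    (Q : I → Type v) [∀ i, AddCommGroup (Q i)] [∀ i, Module R (Q i)]
    (p : ∀ i, N i →ₗ[R] Q i) (hp : ∀ i, Function.Surjective (p i))
    (hker : ∀ i x, p i x = 0 ↔ (x : E) ∈ ⨆ j : Set.Iio i, N j)
    [∀ i, Module.Projective R (Q i)] :
    Module.Projective R ↥(⨆ i, N i) := by
  classical
  have hs : ∀ i, ∃ s : Q i →ₗ[R] N i, (p i).comp s = LinearMap.id := fun i =>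
    LinearMap.exists_rightInverse_of_surjective _ (LinearMap.range_eq_top.2 (hp i))
  choose s hs using hs
  have hs' : ∀ i q, p i (s i q) = q := fun i q => LinearMap.congr_fun (hs i) q
  let φ : (Π₀ i, Q i) →ₗ[R] E := DFinsupp.lsum ℕ fun i => (N i).subtype ∘ₗ s i
  have hsingle : ∀ i q, φ (DFinsupp.single i q) = s i q := fun i q => by simp [φ]
  have hφ : ∀ q, φ q = ∑ i ∈ q.support, (s i (q i) : E) := by
    intro q
    simp only [φ, DFinsupp.lsum_apply_apply, DFinsupp.sumAddHom_apply]
    rfl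
  have hinj : Function.Injective φ := by
    refine (injective_iff_map_eq_zero φ).2 fun q hq => ?_
    by_contra hne
    have hsupp : q.support.Nonempty := by
      rwa [Finset.nonempty_iff_ne_empty, Ne, DFinsupp.support_eq_empty]
    set i := q.support.max' hsupp with hi
    have hmem : i ∈ q.support := Finset.max'_mem _ _
    refine (DFinsupp.mem_support_iff.1 hmem) ?_
    rw [← hs' i (q i), hker]
    rw [hφ, ← Finset.add_sum_erase _ _ hmem] at hq
    rw [eq_neg_of_add_eq_zero_left hq]
    refine Submodule.neg_mem _ (Submodule.sum_mem _ fun j hj => ?_)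
    have hji : j < i := lt_of_le_of_ne (Finset.le_max' _ _ (Finset.mem_of_mem_erase hj))
      (Finset.ne_of_mem_erase hj)
    exact Submodule.mem_iSup_of_mem (⟨j, hji⟩ : Set.Iio i) (s j (q j)).2
  have hle : ∀ i, N i ≤ LinearMap.range φ := by
    intro i
    induction i using WellFoundedLT.induction with
    | ind i ih =>
    intro x hx
    have h1 : p i (⟨x, hx⟩ - s i (p i ⟨x, hx⟩)) = 0 := by rw [map_sub, hs', sub_self]
    have h2 : x - s i (p i ⟨x, hx⟩) ∈ LinearMap.range φ :=
      (iSup_le fun j : Set.Iio i => ih j j.2) ((hker i _).1 h1)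
    have h3 := (LinearMap.range φ).add_mem h2 ⟨_, hsingle i (p i ⟨x, hx⟩)⟩
    rwa [sub_add_cancel] at h3
  have hrange : LinearMap.range φ = ⨆ i, N i := by
    refine le_antisymm ?_ (iSup_le hle)
    rintro _ ⟨q, rfl⟩
    rw [hφ]
    exact Submodule.sum_mem _ fun i _ => Submodule.mem_iSup_of_mem i (s i (q i)).2
  exact Module.Projective.of_equiv' ((LinearEquiv.ofInjective φ hinj).trans
    (LinearEquiv.ofEq _ _ hrange))

end Filtration

/-! ### Functorial syzygies and Auslander's lemma. -/

section Syzygy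

open CategoryTheory

variable {R : Type u} [Ring R] {E : Type u} [AddCommGroup E] [Module R E]

/-- The relations between the nonzero elements of a submodule `N` of `E`. -/
noncomputable def Submodule.syzygy (N : Submodule R E) : Submodule R (E →₀ R) :=
  LinearMap.ker (Finsupp.linearCombination R id) ⊓ Finsupp.supported R R ((N : Set E) \ {0})

theorem Submodule.mem_syzygy {N : Submodule R E} {z : E →₀ R} :
    z ∈ N.syzygy ↔ Finsupp.linearCombination R id z = 0 ∧ (z.support : Set E) ⊆ (N : Set E) \ {0} :=
  Iff.rfl

theorem Submodule.syzygy_mono : Monotone (Submodule.syzygy : Submodule R E → _) := fun _ _ h =>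
  inf_le_inf le_rfl (Finsupp.supported_mono (Set.sdiff_subset_sdiff_left h))

/-- Leaving out the generator `0` makes the syzygy of `⊥` vanish, so this also holds for empty `I`,
as needed below the least index of a filtration. -/
theorem Submodule.iSup_syzygy {I : Type w} [LinearOrder I] {N : I → Submodule R E}
    (hN : Monotone N) : ⨆ i, (N i).syzygy = (⨆ i, N i).syzygy := by
  refine le_antisymm (iSup_le fun i => syzygy_mono (le_iSup N i)) fun z hz => ?_
  have hsup : ((⨆ i, N i : Submodule R E) : Set E) \ {0} = ⋃ i, (N i : Set E) \ {0} := by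
    ext x
    simp only [Set.mem_sdiff, SetLike.mem_coe, Submodule.mem_iSup_of_monotone hN, Set.mem_iUnion,
      Set.mem_singleton_iff]
    tauto
  have hz2 := hz.2
  rw [hsup, SetLike.mem_coe, Finsupp.supported_iUnion, Submodule.mem_iSup_of_monotone
    (fun i j h => Finsupp.supported_mono (Set.sdiff_subset_sdiff_left (hN h)))] at hz2
  obtain rfl | ⟨i, hi⟩ := hz2
  · exact zero_mem _
  · exact mem_iSup_of_mem i ⟨hz.1, hi⟩

theorem projective_supported {E : Type v} (s : Set E) : Module.Projective R (Finsupp.supported R R s) :=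
  Module.Projective.of_equiv' (Finsupp.supportedEquivFinsupp s).symm

theorem Submodule.linearCombination_mem {N : Submodule R E} {s : Set E} (hs : s ⊆ N) {z : E →₀ R}
    (hz : z ∈ Finsupp.supported R R s) : Finsupp.linearCombination R id z ∈ N := by
  rw [Finsupp.linearCombination_apply]
  exact N.sum_mem fun x hx => N.smul_mem _ (hs (hz hx))

/-- The map sending a formal combination of elements of `s ⊆ N` to its value in `N`. -/
noncomputable def Submodule.evalSupported (N : Submodule R E) {s : Set E} (hs : s ⊆ N) :
    Finsupp.supported R R s →ₗ[R] N :=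
  (Finsupp.linearCombination R id ∘ₗ (Finsupp.supported R R s).subtype).codRestrict N
    fun z => N.linearCombination_mem hs z.2

theorem Submodule.hasProjectiveDimensionLE_succ_iff_syzygy (N : Submodule R E) (n : ℕ) :
    HasProjectiveDimensionLE (ModuleCat.of R N) (n + 1) ↔
      HasProjectiveDimensionLE (ModuleCat.of R N.syzygy) n := by
  have := projective_supported (R := R) ((N : Set E) \ {0})
  refine hasProjectiveDimensionLE_of_exact_of_projective
    (B := Finsupp.supported R R ((N : Set E) \ {0}))
    (Submodule.inclusion (inf_le_right : N.syzygy ≤ _))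
    (N.evalSupported (Set.sdiff_subset : (N : Set E) \ {0} ⊆ N))
    ?_ ?_ ?_
  · exact Submodule.inclusion_injective _
  · intro x
    by_cases hx : (x : E) = 0
    · exact ⟨0, by rw [map_zero]; exact (Subtype.ext hx).symm⟩
    · exact ⟨⟨Finsupp.single x 1, Finsupp.single_mem_supported R _ ⟨x.2, hx⟩⟩,
        Subtype.ext (by simp [evalSupported])⟩
  · ext z
    constructor
    · rintro ⟨y, rfl⟩
      exact Subtype.ext y.2.1
    · intro hz
      exact ⟨⟨z, congrArg Subtype.val hz, z.2⟩, rfl⟩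

/-- `K` is the kernel of the map to `Q` from the free module on `N \ N'`, and `p'` keeps only the
coefficients there; so `K` is a syzygy of `Q`. -/
theorem Submodule.exists_syzygy_quotient {N N' : Submodule R E} (hle : N' ≤ N) {Q : Type u}
    [AddCommGroup Q] [Module R Q] (p : N →ₗ[R] Q) (hp : Function.Surjective p)
    (hker : ∀ x, p x = 0 ↔ (x : E) ∈ N') :
    ∃ (K : Type u) (_ : AddCommGroup K) (_ : Module R K) (p' : N.syzygy →ₗ[R] K),
      Function.Surjective p' ∧ (∀ z, p' z = 0 ↔ (z : E →₀ R) ∈ N'.syzygy) ∧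
      ∀ n, HasProjectiveDimensionLE (ModuleCat.of R Q) (n + 1) →
        HasProjectiveDimensionLE (ModuleCat.of R K) n := by
  classical
  set D : Set E := (N : Set E) \ N' with hD
  have hDN : D ⊆ N := Set.sdiff_subset
  let ρ : Finsupp.supported R R D →ₗ[R] Q := p ∘ₗ N.evalSupported hDN
  have hρ : Function.Surjective ρ := by
    intro y
    obtain ⟨x, rfl⟩ := hp y
    by_cases hx : (x : E) ∈ N'
    · exact ⟨0, by rw [map_zero, (hker x).2 hx]⟩
    · refine ⟨⟨Finsupp.single x 1, Finsupp.single_mem_supported R _ ⟨x.2, hx⟩⟩, ?_⟩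
      exact congrArg p (Subtype.ext (by simp [evalSupported]))
  have hρ0 : ∀ y, ρ y = 0 ↔ Finsupp.linearCombination R id (y : E →₀ R) ∈ N' :=
    fun y => hker _
  have hres : ∀ z ∈ N.syzygy, Finsupp.restrictDom R R D z ∈ LinearMap.ker ρ := by
    intro z hz
    rw [LinearMap.mem_ker, hρ0, Finsupp.restrictDom_apply]
    have h1 := Finsupp.filter_add_filter_not z (· ∈ D)
    have h2 := congrArg (Finsupp.linearCombination R id) h1
    rw [map_add, LinearMap.mem_ker.1 hz.1] at h2
    rw [eq_neg_of_add_eq_zero_left h2]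
    refine N'.neg_mem (N'.linearCombination_mem le_rfl ?_)
    intro x hx
    rw [Finset.mem_coe, Finsupp.support_filter, Finset.mem_filter] at hx
    by_contra hx'
    exact hx.2 ⟨(hz.2 hx.1).1, hx'⟩
  let e : Finsupp.supported R R D ≃ₗ[R] (D →₀ R) := Finsupp.supportedEquivFinsupp D
  let ρ' : (D →₀ R) →ₗ[R] Q := ρ ∘ₗ e.symm.toLinearMap
  let p' : N.syzygy →ₗ[R] LinearMap.ker ρ' :=
    (e.toLinearMap ∘ₗ Finsupp.restrictDom R R D ∘ₗ N.syzygy.subtype).codRestrict _ fun z => by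
      change ρ (e.symm (e (Finsupp.restrictDom R R D z))) = 0
      rw [e.symm_apply_apply]
      exact hres z z.2
  have hp' : ∀ (z : N.syzygy) (y : LinearMap.ker ρ'), p' z = y ↔
      Finsupp.filter (· ∈ D) (z : E →₀ R) = (e.symm (y : D →₀ R) : E →₀ R) := by
    intro z y
    rw [Subtype.ext_iff]
    change e (Finsupp.restrictDom R R D z) = (y : D →₀ R) ↔ _
    rw [← LinearEquiv.eq_symm_apply, Subtype.ext_iff]
    rfl
  refine ⟨LinearMap.ker ρ', inferInstance, inferInstance, p', ?_, ?_, ?_⟩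
  · intro v
    obtain ⟨⟨y, hyD⟩, hy⟩ : ∃ y, y = e.symm v := ⟨_, rfl⟩
    have hx : Finsupp.linearCombination R id y ∈ N' := by
      have := (hρ0 (e.symm v)).1 (LinearMap.mem_ker.1 v.2)
      rwa [← hy] at this
    set x := Finsupp.linearCombination R id y with hxy
    have hy' : (y.support : Set E) ⊆ (N : Set E) \ {0} := fun a ha =>
      ⟨(hyD ha).1, fun h => (hyD ha).2 (by rw [Set.mem_singleton_iff.1 h]; exact N'.zero_mem)⟩
    -- To lift `y`, subtract the generator at its value `x ∈ N'`; for `x = 0` there is no such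
    -- generator and `y` is already a relation.
    by_cases hx0 : x = 0
    · refine ⟨⟨y, hx0, hy'⟩, (hp' _ _).2 ?_⟩
      rw [← hy]
      exact Finsupp.filter_eq_self_iff _ _ |>.2 fun a ha => hyD (Finsupp.mem_support_iff.2 ha)
    · refine ⟨⟨y - Finsupp.single x 1, ?_, ?_⟩, (hp' _ _).2 ?_⟩
      · simp [← hxy]
      · exact Submodule.sub_mem _ hy' (Finsupp.single_mem_supported R _ ⟨hle hx, hx0⟩)
      · rw [← hy]
        have h1 : Finsupp.filter (· ∈ D) y = y :=
          Finsupp.filter_eq_self_iff _ _ |>.2 fun a ha => hyD (Finsupp.mem_support_iff.2 ha)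
        have h2 : Finsupp.filter (· ∈ D) (Finsupp.single x (1 : R)) = 0 :=
          Finsupp.filter_single_of_neg _ fun h => h.2 hx
        rw [Finsupp.filter_sub, h1, h2, sub_zero]
  · intro z
    rw [hp', Submodule.coe_zero, map_zero, Submodule.coe_zero, Finsupp.filter_eq_zero_iff, mem_syzygy]
    constructor
    · intro h
      refine ⟨z.2.1, fun a ha => ⟨?_, (z.2.2 ha).2⟩⟩
      by_contra ha'
      exact Finsupp.mem_support_iff.1 ha (h a ⟨(z.2.2 ha).1, ha'⟩)
    · intro h a ha
      by_contra h0
      exact ha.2 (h.2 (Finsupp.mem_support_iff.2 h0)).1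
  · intro n hn
    exact (hasProjectiveDimensionLE_of_exact_of_projective (LinearMap.ker ρ').subtype ρ'
      Subtype.val_injective (hρ.comp e.symm.surjective) (Submodule.range_subtype _)).1 hn

/-- Auslander's lemma: the projective dimension of the union of a filtration is bounded by the
projective dimensions of its factors. -/
theorem hasProjectiveDimensionLE_iSup_of_filtration {I : Type w} [LinearOrder I] [WellFoundedLT I]
    (n : ℕ) {E : Type u} [AddCommGroup E] [Module R E]
    (N : I → Submodule R E) (hN : Monotone N)
    (Q : I → Type u) [∀ i, AddCommGroup (Q i)] [∀ i, Module R (Q i)]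
    (p : ∀ i, N i →ₗ[R] Q i) (hp : ∀ i, Function.Surjective (p i))
    (hker : ∀ i x, p i x = 0 ↔ (x : E) ∈ ⨆ j : Set.Iio i, N j)
    (hQ : ∀ i, HasProjectiveDimensionLE (ModuleCat.of R (Q i)) n) :
    HasProjectiveDimensionLE (ModuleCat.of R ↥(⨆ i, N i)) n := by
  induction n generalizing E Q with
  | zero =>
    have := fun i => (hasProjectiveDimensionLE_zero_iff _).1 (hQ i)
    rw [hasProjectiveDimensionLE_zero_iff]
    exact projective_iSup_of_filtration N Q p hp hker
  | succ n ih =>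
    have hle : ∀ i, ⨆ j : Set.Iio i, N j ≤ N i := fun i => iSup_le fun j => hN (le_of_lt j.2)
    choose K _ _ p' hp' hker' hK using fun i =>
      Submodule.exists_syzygy_quotient (hle i) (p i) (hp i) (hker i)
    -- The syzygies filter the syzygy of the union, and both bounds drop by one.
    rw [Submodule.hasProjectiveDimensionLE_succ_iff_syzygy, ← Submodule.iSup_syzygy hN]
    refine ih (fun i => (N i).syzygy) (Submodule.syzygy_mono.comp hN) K p' hp' ?_
      fun i => hK i n (hQ i)
    intro i x
    rw [hker' i x, ← Submodule.iSup_syzygy (N := fun j : Set.Iio i => N j)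
      (fun a b (h : a ≤ b) => hN h)]

end Syzygy

/-! ### Cardinality of finitary closures. -/

section FinitaryClosure

open Cardinal

theorem mk_iUnion_le_of_forall_le {α ι : Type u} {κ : Cardinal.{u}} (hκ : ℵ₀ ≤ κ) (hι : #ι ≤ κ)
    {f : ι → Set α} (hf : ∀ i, #(f i) ≤ κ) : #(⋃ i, f i : Set α) ≤ κ :=
  (mk_iUnion_le f).trans ((mul_le_mul' hι (ciSup_le' hf)).trans (mul_eq_self hκ).le)

theorem mk_finset_le_of_le {α : Type u} {κ : Cardinal.{u}} (hκ : ℵ₀ ≤ κ) (hα : #α ≤ κ) :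
    #(Finset α) ≤ κ := by
  rcases finite_or_infinite α with h | h
  · exact (lt_aleph0_of_finite _).le.trans hκ
  · rwa [mk_finset_of_infinite]

/-- A finitary closure operation adds at most countably many elements to an infinite set. -/
theorem exists_finitary_closure {J : Type} (c : Finset J → Finset J) :
    ∃ cl : Set J → Set J, (∀ X, X ⊆ cl X) ∧ Monotone cl ∧
      (∀ X (T : Finset J), (T : Set J) ⊆ cl X → (c T : Set J) ⊆ cl X) ∧
      ∀ (X : Set J) (κ : Cardinal.{0}), ℵ₀ ≤ κ → #X ≤ κ → #(cl X) ≤ κ := by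
  let step : Set J → Set J := fun X => X ∪ ⋃ T : Finset X, (c (T.map (.subtype _)) : Set J)
  have le_step : ∀ X, X ⊆ step X := fun X => Set.subset_union_left
  have mem_step : ∀ {X : Set J} {T : Finset J}, (T : Set J) ⊆ X → (c T : Set J) ⊆ step X := by
    classical
    intro X T hT x hx
    refine Or.inr (Set.mem_iUnion.2 ⟨T.subtype (· ∈ X), ?_⟩)
    rwa [Finset.subtype_map_of_mem fun t ht => hT ht]
  have step_mono : Monotone step := by
    rintro X Y hXY x (hx | hx)
    · exact Or.inl (hXY hx)
    · obtain ⟨T, hT⟩ := Set.mem_iUnion.1 hx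
      refine mem_step (fun t ht => hXY ?_) hT
      obtain ⟨a, -, rfl⟩ := Finset.mem_map.1 ht
      exact a.2
  have card_step : ∀ (X : Set J) (κ : Cardinal.{0}), ℵ₀ ≤ κ → #X ≤ κ → #(step X) ≤ κ := by
    intro X κ hκ hX
    refine (mk_union_le _ _).trans (add_le_of_le hκ hX ?_)
    exact mk_iUnion_le_of_forall_le hκ (mk_finset_le_of_le hκ hX) fun T =>
      (lt_aleph0_of_finite _).le.trans hκ
  have mono_iter : ∀ X, Monotone fun n => step^[n] X := fun X =>
    monotone_nat_of_le_succ fun n => by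
      rw [Function.iterate_succ_apply']; exact le_step _
  refine ⟨fun X => ⋃ n, step^[n] X, fun X => Set.subset_iUnion (fun n => step^[n] X) 0,
    fun X Y h => Set.iUnion_mono fun n => step_mono.iterate n h, ?_, ?_⟩
  · intro X T hT
    obtain ⟨n, hn⟩ := (mono_iter X).directed_le.exists_mem_subset_of_finset_subset_biUnion hT
    refine (mem_step hn).trans ?_
    rw [← Function.iterate_succ_apply' step]
    exact Set.subset_iUnion (fun n => step^[n] X) (n + 1)
  · intro X κ hκ hX
    refine mk_iUnion_le_of_forall_le hκ (by simpa using hκ) fun n => ?_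
    induction n with
    | zero => exact hX
    | succ n ih => rw [Function.iterate_succ_apply']; exact card_step _ κ hκ ih

end FinitaryClosure

/-! ### Induction on the number of generators. -/

section Main

open Cardinal CategoryTheory

variable {R : Type u} [Ring R]

theorem Submodule.FG.exists_finset_le_span_image {P : Type v} [AddCommGroup P] [Module R P]
    {J : Type w} {g : J → P} {X : Set J} {L : Submodule R P} (hL : L.FG)
    (hle : L ≤ span R (g '' X)) :
    ∃ c : Finset J, (c : Set J) ⊆ X ∧ L ≤ span R (g '' c) := by
  classical
  obtain ⟨t, rfl⟩ := hL
  obtain ⟨T, hT, htT⟩ := subset_span_finite_of_subset_span (span_le.1 hle)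
  obtain ⟨c, hc, rfl⟩ := Finset.subset_set_image_iff.1 hT
  exact ⟨c, hc, span_le.2 (by rwa [← Finset.coe_image])⟩

/-- `c T` indexes generators whose span contains the range of an endomorphism fixing the span of `g
'' T`. Setting `c ∅ = ∅` makes the empty set closed. -/
theorem Submodule.IsLocallySplit.exists_finset_map {P : Type v} [AddCommGroup P] [Module R P]
    {J : Type w} {g : J → P} (h : (span R (Set.range g)).IsLocallySplit) :
    ∃ c : Finset J → Finset J, c ∅ = ∅ ∧ ∀ X : Set J,
      (∀ T : Finset J, (T : Set J) ⊆ X → (c T : Set J) ⊆ X) →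
        (span R (g '' X)).IsLocallySplit := by
  classical
  have key : ∀ T : Finset J, ∃ (c : Finset J) (f : P →ₗ[R] P),
      (∀ x, f x ∈ span R (g '' c)) ∧ ∀ x ∈ span R (g '' T), f x = x := by
    intro T
    obtain ⟨f, L', fg, le, mem, fix⟩ := h (span R (g '' T)) (fg_span (T.finite_toSet.image g))
      (span_mono (Set.image_subset_range _ _))
    rw [← Set.image_univ] at le
    obtain ⟨c, -, hc⟩ := fg.exists_finset_le_span_image le
    exact ⟨c, f, fun x => hc (mem x), fix⟩
  choose c f mem fix using key
  refine ⟨fun T => if T = ∅ then ∅ else c T, if_pos rfl, fun X hX L hL hle => ?_⟩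
  obtain ⟨T, hT, hLT⟩ := hL.exists_finset_le_span_image hle
  by_cases h0 : T = ∅
  · subst h0
    refine ⟨0, ⊥, fg_bot, bot_le, by simp, fun x hx => ?_⟩
    have := hLT hx
    simp only [Finset.coe_empty, Set.image_empty, span_empty, mem_bot] at this
    simp [this]
  · refine ⟨f T, span R (g '' c T), fg_span ((c T).finite_toSet.image g), ?_, mem T,
      fun x hx => fix T x (hLT hx)⟩
    have := hX T hT
    simp only [if_neg h0] at this
    exact span_mono (Set.image_mono this)

theorem Submodule.IsLocallySplit.hasProjectiveDimensionLE {P : Type u} [AddCommGroup P]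
    [Module R P] [Module.Projective R P] (n : ℕ) {J : Type} (hJ : #J ≤ aleph (n : Ordinal))
    (g : J → P) (h : (span R (Set.range g)).IsLocallySplit) :
    HasProjectiveDimensionLE (ModuleCat.of R ↥(span R (Set.range g))) n := by
  induction n generalizing J with
  | zero =>
    rw [hasProjectiveDimensionLE_zero_iff]
    rw [Nat.cast_zero, aleph_zero] at hJ
    have : Countable J := mk_le_aleph0_iff.1 hJ
    rcases isEmpty_or_nonempty J with hE | hE
    · exact h.projective_of_countable (fun _ => 0) (by simp [Set.range_eq_empty g])
    · obtain ⟨s, hs⟩ := exists_surjective_nat J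
      exact h.projective_of_countable (g ∘ s) (by rw [hs.range_comp])
  | succ n ih =>
    have hn : ℵ₀ ≤ aleph (n : Ordinal.{0}) := aleph0_le_aleph _
    rw [Nat.cast_succ, ← succ_aleph] at hJ
    obtain ⟨c, hc0, hc⟩ := h.exists_finset_map
    obtain ⟨cl, sub_cl, cl_mono, cl_closed, cl_card⟩ := exists_finitary_closure c
    have ih' : ∀ X : Set J, (∀ T : Finset J, (T : Set J) ⊆ X → (c T : Set J) ⊆ X) →
        #X ≤ aleph (n : Ordinal) →
        HasProjectiveDimensionLE (ModuleCat.of R ↥(span R (g '' X))) n := by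
      intro X hX hcard
      have := ih hcard (g ∘ Subtype.val)
      rw [Set.range_comp, Subtype.range_coe] at this
      exact this (hc X hX)
    -- In a well-order of least type, proper initial segments have cardinality below `#J`, hence at
    -- most `ℵ_n`.
    obtain ⟨_, _, hord⟩ := exists_ord_eq_type_lt J
    have card_Iio : ∀ i : J, #(Set.Iio i) ≤ aleph (n : Ordinal) := fun i =>
      Order.lt_succ_iff.1 ((mk_Iio_lt i hord).trans_le hJ)
    have card_Iic : ∀ i : J, #(Set.Iic i) ≤ aleph (n : Ordinal) := fun i => by
      rw [← Set.Iio_union_right]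
      exact (mk_union_le _ _).trans (add_le_of_le hn (card_Iio i)
        ((lt_aleph0_of_finite _).le.trans hn))
    let X : J → Set J := fun i => cl (Set.Iic i)
    have X_mono : Monotone X := fun i j hij => cl_mono (Set.Iic_subset_Iic.2 hij)
    have X_card : ∀ i, #(X i) ≤ aleph (n : Ordinal) := fun i => cl_card _ _ hn (card_Iic i)
    let N : J → Submodule R P := fun i => span R (g '' X i)
    have N_mono : Monotone N := fun i j hij => span_mono (Set.image_mono (X_mono hij))
    have hsup : ⨆ i, N i = span R (Set.range g) := by
      refine le_antisymm (iSup_le fun i => span_mono (Set.image_subset_range _ _)) (span_le.2 ?_)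
      rintro _ ⟨i, rfl⟩
      exact mem_iSup_of_mem i (subset_span ⟨i, sub_cl _ Set.self_mem_Iic, rfl⟩)
    have hlt : ∀ i : J, HasProjectiveDimensionLE
        (ModuleCat.of R ↥(⨆ j : Set.Iio i, N (j : J))) n := by
      intro i
      have : (⨆ j : Set.Iio i, N (j : J)) = span R (g '' ⋃ j : Set.Iio i, X j) := by
        rw [Set.image_iUnion, span_iUnion]
      rw [this]
      refine ih' _ (fun T hT => ?_) (mk_iUnion_le_of_forall_le hn (card_Iio i) fun j => X_card j)
      -- The union of the chain is closed because a nonempty finite `T` lies in a single `X j`; for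
      -- the least `i` the union is empty and only `c ∅ = ∅` applies.
      rcases T.eq_empty_or_nonempty with rfl | ⟨t, ht⟩
      · simp [hc0]
      · obtain ⟨j₀, -⟩ := Set.mem_iUnion.1 (hT ht)
        have : Nonempty (Set.Iio i) := ⟨j₀⟩
        have hdir : Directed (· ⊆ ·) fun j : Set.Iio i => X j :=
          Monotone.directed_le fun a b (hab : a ≤ b) => X_mono hab
        obtain ⟨j, hj⟩ := hdir.exists_mem_subset_of_finset_subset_biUnion hT
        exact (cl_closed _ T hj).trans (Set.subset_iUnion (fun j : Set.Iio i => X j) j)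
    have hle : ∀ i : J, ⨆ j : Set.Iio i, N j ≤ N i := fun i => iSup_le fun j => N_mono (le_of_lt j.2)
    rw [← hsup]
    refine hasProjectiveDimensionLE_iSup_of_filtration (n + 1) N N_mono
      (fun i => N i ⧸ (⨆ j : Set.Iio i, N j).submoduleOf (N i)) (fun i => mkQ _)
      (fun i => mkQ_surjective _) ?_ ?_
    · intro i x
      rw [mkQ_apply, Submodule.Quotient.mk_eq_zero]
      rfl
    · intro i
      refine hasProjectiveDimensionLE_succ_of_exact (inclusion (hle i)) (mkQ _)
        (inclusion_injective _) (mkQ_surjective _) ?_ (hlt i)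
        (hasProjectiveDimensionLE_mono (Nat.le_succ n) (ih' _ (cl_closed _) (X_card i)))
      rw [range_inclusion, ker_mkQ]
      rfl

end Main

theorem mainTheorem7 (R : Type u) [Ring R] [Small.{v} R] (m : ℕ)
    (F : Type v) [AddCommGroup F] [Module R F]
    (hpres : IsCardPresentable (Cardinal.aleph.{0} (m : Ordinal.{0})) R F)
    (hflat : IsFlatModule R F) :
    CategoryTheory.projectiveDimension (ModuleCat.of R F) ≤ (m : WithBot ℕ∞) := by
  obtain ⟨ι, σ, φ, -, hσ, ⟨e⟩⟩ := hpres
  rw [← ModuleCat.projectiveDimension_eq_of_linearEquiv.{u, v}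
    (M := ModuleCat.of R ((ι →₀ R) ⧸ LinearMap.range φ)) (N := ModuleCat.of R F) e,
    CategoryTheory.projectiveDimension_le_iff]
  have hK : (LinearMap.range φ).IsLocallySplit := by
    have := hflat.isLocallySplit_ker (e.toLinearMap ∘ₗ (LinearMap.range φ).mkQ)
      (e.surjective.comp (Submodule.mkQ_surjective _))
    rwa [LinearEquiv.ker_comp, Submodule.ker_mkQ] at this
  cases m with
  | zero =>
    rw [Nat.cast_zero, Cardinal.aleph_zero] at hσ
    have : Finite σ := Cardinal.lt_aleph0_iff_finite.1 hσ
    have hfg : (LinearMap.range φ).FG := by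
      rw [LinearMap.range_eq_map]
      exact Module.Finite.fg_top.map φ
    exact (hasProjectiveDimensionLE_zero_iff _).2 (hK.projective_quotient hfg)
  | succ n =>
    -- Fewer than `ℵ_{n+1}` relations means at most `ℵ_n`, so the kernel has dimension at most `n`
    -- and the quotient at most `n + 1`.
    rw [Nat.cast_succ, ← Cardinal.succ_aleph, Order.lt_succ_iff] at hσ
    have hspan : Submodule.span R (Set.range fun s => φ (Finsupp.single s 1)) =
        LinearMap.range φ := by
      rw [LinearMap.range_eq_map, ← (Finsupp.basisSingleOne (R := R) (ι := σ)).span_eq,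
        Submodule.map_span, ← Set.range_comp]
      rfl
    rw [← hspan] at hK
    have hpd := hK.hasProjectiveDimensionLE n hσ
    rw [hspan] at hpd
    exact (hasProjectiveDimensionLE_of_exact_of_projective (LinearMap.range φ).subtype
      (LinearMap.range φ).mkQ Subtype.val_injective (Submodule.mkQ_surjective _)
      (by rw [Submodule.range_subtype, Submodule.ker_mkQ])).2 hpd
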